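/- Let $K$ be a field of characteristic $0$, let $d\ge 2$, and let $KX_d$ be the $K$-vector space with basis $X_d=\{x_1,\dots,x_d\}$. For $k\ge 0$ let $V_k$ denote the $SL_2(K)$-module of binary forms of degree $k$ over $K$. Suppose that $SL_2(K)$ acts linearly on $KX_d$ and that there is an isomorphism of $SL_2(K)$-modules \[ KX_d\cong V_1\oplus \underbrace{V_0\oplus\cdots\oplus V_0}_{d-2} \] under which $V_1$ corresponds to the span of $x_1,x_2$ and $V_0\oplus\cdots\oplus V_0$ corresponds to the span of $x_3,\dots,x_d$. Let $F_d=L_d/L_d''$ be the free metabelian Lie algebra over $K$ freely generated by $X_d$, where $L_d$ is the free Lie algebra on $X_d$ and $L_d''=[[L_d,L_d],[L_d,L_d]]$, and let $SL_2(K)$ act on $F_d$ by the Lie algebra automorphisms extending its action on $KX_d$. Then the Lie algebra of invariants $F_d^{SL_2(K)}$ is generated, as a Lie algebra over $K$, by $[x_2,x_1]$ and $x_3,\dots,x_d$. -/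

import Mathlib

open scoped MatrixGroups

noncomputable section

universe u v w

/-- `SL₂(K)` acts on polynomial functions on `K²` by `(g • f)(v) = f (g⁻¹ v)`: the coordinate
function `u_j` is sent to `∑ i, (g⁻¹)_{ji} u_i`. -/
def binarySubst (K : Type u) [Field K] (g : SL(2, K)) :
    MvPolynomial (Fin 2) K →ₐ[K] MvPolynomial (Fin 2) K :=
  MvPolynomial.aeval fun j => ∑ i, MvPolynomial.C ((g⁻¹ : SL(2, K)) j i) * MvPolynomial.X i

theorem binarySubst_one (K : Type u) [Field K] : binarySubst K 1 = AlgHom.id K _ := by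
  ext j : 1
  simp [binarySubst, Matrix.one_apply]

theorem binarySubst_mul (K : Type u) [Field K] (g h : SL(2, K)) :
    binarySubst K (g * h) = (binarySubst K g).comp (binarySubst K h) := by
  ext j : 1
  simp [binarySubst, Matrix.mul_apply, Fin.sum_univ_two, -Matrix.SpecialLinearGroup.coe_inv]
  ring

theorem binarySubst_mem (K : Type u) [Field K] (k : ℕ) (g : SL(2, K))
    {f : MvPolynomial (Fin 2) K} (hf : f ∈ MvPolynomial.homogeneousSubmodule (Fin 2) K k) :
    binarySubst K g f ∈ MvPolynomial.homogeneousSubmodule (Fin 2) K k := by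
  rw [MvPolynomial.mem_homogeneousSubmodule] at hf ⊢
  have := hf.aeval (fun j => ∑ i, MvPolynomial.C ((g⁻¹ : SL(2, K)) j i) * MvPolynomial.X i)
    (n := 1) (fun j => MvPolynomial.IsHomogeneous.sum _ _ _ fun i _ => by
      simpa using (MvPolynomial.isHomogeneous_C (Fin 2) ((g⁻¹ : SL(2, K)) j i)).mul
        (MvPolynomial.isHomogeneous_X K i))
  simpa [binarySubst] using this

/-- `V_k`: the `SL₂(K)`-module of binary forms of degree `k`. -/
def binaryForms (K : Type u) [Field K] (k : ℕ) :
    Representation K SL(2, K) (MvPolynomial.homogeneousSubmodule (Fin 2) K k) where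
  toFun g := (binarySubst K g).toLinearMap.restrict fun _ hf => binarySubst_mem K k g hf
  map_one' := by
    ext f : 2
    simp [binarySubst_one, LinearMap.restrict_apply]
  map_mul' g h := by
    ext f : 2
    simp only [binarySubst_mul]
    rfl

/-- The free metabelian Lie algebra `L / L''` freely generated by `X`, where `L` is the free Lie
algebra on `X` over `K` and `L'' = [[L, L], [L, L]]`. -/
abbrev FreeMetabelianLieAlgebra (K : Type u) [Field K] (X : Type v) : Type (max u v) :=
  FreeLieAlgebra K X ⧸ LieAlgebra.derivedSeries K (FreeLieAlgebra K X) 2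

namespace FreeMetabelianLieAlgebra

variable {K : Type u} [Field K] {X : Type v}

/-- The quotient map from the free Lie algebra, as a homomorphism of Lie algebras. -/
def mkHom (K : Type u) [Field K] (X : Type v) :
    FreeLieAlgebra K X →ₗ⁅K⁆ FreeMetabelianLieAlgebra K X where
  toLinearMap := (LieSubmodule.Quotient.mk' (LieAlgebra.derivedSeries K (FreeLieAlgebra K X) 2) :
    FreeLieAlgebra K X →ₗ[K] FreeMetabelianLieAlgebra K X)
  map_lie' {a b} := LieSubmodule.Quotient.mk_bracket _ a b

theorem mkHom_surjective : Function.Surjective (mkHom K X) :=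
  LieSubmodule.Quotient.surjective_mk' _

theorem mkHom_eq_zero {a : FreeLieAlgebra K X} :
    mkHom K X a = 0 ↔ a ∈ LieAlgebra.derivedSeries K (FreeLieAlgebra K X) 2 :=
  LieSubmodule.Quotient.mk_eq_zero _

/-- The free generator `x_i`. -/
def x (K : Type u) [Field K] {X : Type v} (i : X) : FreeMetabelianLieAlgebra K X :=
  mkHom K X (FreeLieAlgebra.of K i)

theorem derivedSeries_two_eq_bot :
    LieAlgebra.derivedSeries K (FreeMetabelianLieAlgebra K X) 2 = ⊥ := by
  rw [← LieIdeal.derivedSeries_map_eq 2 (mkHom_surjective (K := K) (X := X)), LieIdeal.map_eq_bot_iff]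
  intro a ha
  exact LieHom.mem_ker.2 (mkHom_eq_zero.2 ha)

theorem lift_derivedSeries {M : Type w} [LieRing M] [LieAlgebra K M]
    (hM : LieAlgebra.derivedSeries K M 2 = ⊥) (f : X → M) {a : FreeLieAlgebra K X}
    (ha : a ∈ LieAlgebra.derivedSeries K (FreeLieAlgebra K X) 2) :
    FreeLieAlgebra.lift K f a = 0 := by
  have h := LieIdeal.derivedSeries_map_le (f := FreeLieAlgebra.lift K f) 2
  rw [hM, le_bot_iff] at h
  have h' := LieIdeal.mem_map (f := FreeLieAlgebra.lift K f) ha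
  rwa [h, LieSubmodule.mem_bot] at h'

/-- The universal property of the free metabelian Lie algebra. -/
def lift {M : Type w} [LieRing M] [LieAlgebra K M]
    (hM : LieAlgebra.derivedSeries K M 2 = ⊥) (f : X → M) :
    FreeMetabelianLieAlgebra K X →ₗ⁅K⁆ M where
  toLinearMap := Submodule.liftQ
    (LieAlgebra.derivedSeries K (FreeLieAlgebra K X) 2).toSubmodule
    (FreeLieAlgebra.lift K f : FreeLieAlgebra K X →ₗ[K] M)
    (fun _ ha => lift_derivedSeries hM f ha)
  map_lie' {a b} := by
    obtain ⟨a, rfl⟩ := mkHom_surjective a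
    obtain ⟨b, rfl⟩ := mkHom_surjective b
    rw [← LieHom.map_lie]
    exact LieHom.map_lie (FreeLieAlgebra.lift K f) a b

theorem lift_x {M : Type w} [LieRing M] [LieAlgebra K M]
    (hM : LieAlgebra.derivedSeries K M 2 = ⊥) (f : X → M) (i : X) : lift hM f (x K i) = f i :=
  FreeLieAlgebra.lift_of_apply f i

theorem hom_ext {M : Type w} [LieRing M] [LieAlgebra K M]
    {φ ψ : FreeMetabelianLieAlgebra K X →ₗ⁅K⁆ M} (h : ∀ i, φ (x K i) = ψ (x K i)) : φ = ψ := by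
  have : φ.comp (mkHom K X) = ψ.comp (mkHom K X) := FreeLieAlgebra.hom_ext h
  ext a
  obtain ⟨a, rfl⟩ := mkHom_surjective a
  exact LieHom.congr_fun this a

/-- The inclusion of the vector space `KX` with basis `X` into the free metabelian Lie algebra. -/
def incl (K : Type u) [Field K] (X : Type v) : (X →₀ K) →ₗ[K] FreeMetabelianLieAlgebra K X :=
  Finsupp.linearCombination K (x K)

/-- The endomorphism of the free metabelian Lie algebra extending a linear map of `KX`. -/
def map (T : (X →₀ K) →ₗ[K] (X →₀ K)) :
    FreeMetabelianLieAlgebra K X →ₗ⁅K⁆ FreeMetabelianLieAlgebra K X :=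
  lift derivedSeries_two_eq_bot fun i => incl K X (T (Finsupp.single i 1))

theorem map_x (T : (X →₀ K) →ₗ[K] (X →₀ K)) (i : X) :
    map T (x K i) = incl K X (T (Finsupp.single i 1)) := lift_x _ _ i

theorem map_incl (T : (X →₀ K) →ₗ[K] (X →₀ K)) (v : X →₀ K) :
    map T (incl K X v) = incl K X (T v) := by
  have : (map T : FreeMetabelianLieAlgebra K X →ₗ[K] _) ∘ₗ incl K X = incl K X ∘ₗ T := by
    ext i
    simp [incl, map_x]
  exact LinearMap.congr_fun this v

theorem map_one : map (1 : (X →₀ K) →ₗ[K] (X →₀ K)) = LieHom.id :=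
  hom_ext fun i => by simp [map_x, incl]

theorem map_mul (S T : Module.End K (X →₀ K)) : map (S * T) = (map S).comp (map T) :=
  hom_ext fun i => by simp [map_x, map_incl]

/-- The diagonal extension to the free metabelian Lie algebra, by Lie algebra homomorphisms,
of a linear action of `G` on `KX`. -/
def action {G : Type w} [Monoid G] (ρ : Representation K G (X →₀ K)) :
    Representation K G (FreeMetabelianLieAlgebra K X) where
  toFun g := (map (ρ g) : FreeMetabelianLieAlgebra K X →ₗ[K] FreeMetabelianLieAlgebra K X)
  map_one' := by
    rw [_root_.map_one, map_one]
    rfl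
  map_mul' g h := by
    rw [_root_.map_mul, map_mul]
    rfl

/-- The Lie algebra of `G`-invariants in the free metabelian Lie algebra. -/
def invariants {G : Type w} [Monoid G] (ρ : Representation K G (X →₀ K)) :
    LieSubalgebra K (FreeMetabelianLieAlgebra K X) where
  toSubmodule := {
    carrier := {f | ∀ g, action ρ g f = f}
    add_mem' := fun ha hb g => by rw [_root_.map_add, ha g, hb g]
    zero_mem' := fun g => _root_.map_zero _
    smul_mem' := fun c a ha g => by rw [_root_.map_smul, ha g] }
  lie_mem' {a b} ha hb g := by
    have h := LieHom.map_lie (map (ρ g)) a b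
    have ha' : map (ρ g) a = a := ha g
    have hb' : map (ρ g) b = b := hb g
    rw [ha', hb'] at h
    exact h

end FreeMetabelianLieAlgebra

end

/-!
Let `F` be the free metabelian Lie algebra on `X = {x_0, …, x_{n+1}}`, `A = K[X]` and `D = [F, F]`.

Since `D` is abelian, the operators `ad x_i` commute on `D`, which makes `D` an `A`-module, generated
by the brackets `⁅x_i, x_j⁆`. The Magnus map is the homomorphism from `F` to the Lie algebra
`A ⋉ A ^ X` sending `x_i` to `(X_i, e_i)`; on `D` it is the `A`-linear map
`⁅x_i, x_j⁆ ↦ X_i e_j - X_j e_i` to `A ^ X`, and it is equivariant for linear maps of `KX`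
(`magnus_map`). In characteristic zero it has an explicit left inverse on `D`: the contraction
`f e_j ↦ ∑ k, ∂_k f • ⁅x_k, x_j⁆`, after each monomial of `f` has been divided by its degree plus one
(`contraction_magnusDerived`). This follows from Euler's identity and the Jacobi identity. So an
element of `D` can be recovered from its image `m` in `A ^ X`, which is invariant when the element
is.

In the basis `x_0, x_1` the group acts through all matrices of determinant one (`exists_matrix`), and
it fixes the other generators. Two group elements already determine the invariants of `A ^ X`: the
torus element with eigenvalues `2, 1/2` and the transvection `x_1 ↦ x_0 + x_1`. The torus element
fixes the difference of the exponents of `X_0` and `X_1` in each component of `m`, and the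
transvection then shows that `m_j` for `j ≥ 2` is free of `X_0` and `X_1`, and that
`m_0 e_0 + m_1 e_1 = p (X_0 e_1 - X_1 e_0)` with `p` free of `X_0` and `X_1`
(`support_succ_of_invariant`, `support_one_of_invariant`, `apply_zero_of_invariant`). The contraction
maps the components with `j ≥ 2` into the subalgebra generated by `x_2, …, x_{n+1}`, and it maps the
last expression to `p • ⁅x_0, x_1⁆`, which is obtained from `⁅x_0, x_1⁆` by bracketing with
`x_2, …, x_{n+1}`. Modulo `D` only linear combinations of `x_2, …, x_{n+1}` are invariant, by the
torus element alone.
-/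

noncomputable section

universe u v w

/-! ### Metabelian Lie algebras -/

namespace LieAlgebra

variable {K : Type u} [CommRing K] {L : Type v} [LieRing L] [LieAlgebra K L]

theorem derivedSeries_succ (k : ℕ) :
    derivedSeries K L (k + 1) = ⁅derivedSeries K L k, derivedSeries K L k⁆ :=
  derivedSeriesOfIdeal_succ K L ⊤ k

theorem derivedSeries_one_le_iff {S : Submodule K L} :
    (derivedSeries K L 1).toSubmodule ≤ S ↔ ∀ a b : L, ⁅a, b⁆ ∈ S := by
  have h : (derivedSeries K L 1).toSubmodule = Submodule.span K {⁅x, y⁆ | (x : L) (y : L)} :=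
    coe_derivedSeries_one_eq K L
  rw [h, Submodule.span_le]
  exact ⟨fun h a b => h ⟨a, b, rfl⟩, by rintro h _ ⟨a, b, rfl⟩; exact h a b⟩

theorem lie_mem_derivedSeries_one (a b : L) : ⁅a, b⁆ ∈ derivedSeries K L 1 :=
  derivedSeries_one_le_iff.1 le_rfl a b

theorem derivedSeries_two_eq_bot_iff :
    derivedSeries K L 2 = ⊥ ↔ ∀ a b c d : L, ⁅⁅a, b⁆, ⁅c, d⁆⁆ = 0 := by
  rw [derivedSeries_succ, LieSubmodule.lie_eq_bot_iff]
  refine ⟨fun h a b c d => h _ (lie_mem_derivedSeries_one a b) _ (lie_mem_derivedSeries_one c d),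
    fun h p hp q hq => ?_⟩
  have h₁ : ∀ c d, ∀ p ∈ derivedSeries K L 1, ⁅⁅c, d⁆, p⁆ = 0 := fun c d =>
    
    (derivedSeries_one_le_iff (S := LinearMap.ker (ad K L ⁅c, d⁆))).2 fun a b => h c d a b
  have h₂ : (derivedSeries K L 1).toSubmodule ≤ LinearMap.ker (ad K L p) :=
    derivedSeries_one_le_iff.2 fun c d => by
      rw [LinearMap.mem_ker, ad_apply, ← lie_skew, h₁ c d p hp, neg_zero]
  exact h₂ hq

theorem lie_eq_zero_of_mem_derivedSeries_one (h : derivedSeries K L 2 = ⊥) {a b : L}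
    (ha : a ∈ derivedSeries K L 1) (hb : b ∈ derivedSeries K L 1) : ⁅a, b⁆ = 0 := by
  rw [derivedSeries_succ, LieSubmodule.lie_eq_bot_iff] at h
  exact h a ha b hb

/-- In a metabelian Lie algebra, a subspace of the derived algebra that contains the brackets of two
generators and is stable under bracketing with generators is the whole derived algebra. -/
theorem derivedSeries_one_le_of_generators (hL : derivedSeries K L 2 = ⊥) {ι : Type w} {x : ι → L}
    (hx : LieSubalgebra.lieSpan K L (Set.range x) = ⊤) {S : Submodule K L}
    (hS : S ≤ (derivedSeries K L 1).toSubmodule) (hxx : ∀ i j, ⁅x i, x j⁆ ∈ S)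
    (hxS : ∀ i, ∀ a ∈ S, ⁅x i, a⁆ ∈ S) : (derivedSeries K L 1).toSubmodule ≤ S := by
  set V := Submodule.span K (Set.range x)
  have hVS : ∀ v ∈ V, ∀ a ∈ S, ⁅v, a⁆ ∈ S := by
    intro v hv a ha
    induction hv using Submodule.span_induction with
    | mem v hv => obtain ⟨i, rfl⟩ := hv; exact hxS i a ha
    | zero => rw [zero_lie]; exact S.zero_mem
    | add v w _ _ hv hw => rw [add_lie]; exact S.add_mem hv hw
    | smul c v _ hv => rw [smul_lie]; exact S.smul_mem c hv
  have hVV : ∀ v ∈ V, ∀ w ∈ V, ⁅v, w⁆ ∈ S := by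
    intro v hv w hw
    induction hv, hw using Submodule.span_induction₂ with
    | mem_mem v w hv hw => obtain ⟨i, rfl⟩ := hv; obtain ⟨j, rfl⟩ := hw; exact hxx i j
    | zero_left => rw [zero_lie]; exact S.zero_mem
    | zero_right => rw [lie_zero]; exact S.zero_mem
    | add_left _ _ _ _ _ _ h₁ h₂ => rw [add_lie]; exact S.add_mem h₁ h₂
    | add_right _ _ _ _ _ _ h₁ h₂ => rw [lie_add]; exact S.add_mem h₁ h₂
    | smul_left c _ _ _ _ h => rw [smul_lie]; exact S.smul_mem c h
    | smul_right c _ _ _ _ h => rw [lie_smul]; exact S.smul_mem c h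
  have key : ∀ a ∈ V ⊔ S, ∀ b ∈ V ⊔ S, ⁅a, b⁆ ∈ S := by
    intro a ha b hb
    obtain ⟨v, hv, c, hc, rfl⟩ := Submodule.mem_sup.1 ha
    obtain ⟨w, hw, d, hd, rfl⟩ := Submodule.mem_sup.1 hb
    rw [add_lie, lie_add, lie_add, lie_eq_zero_of_mem_derivedSeries_one hL (hS hc) (hS hd),
      add_zero, ← lie_skew c]
    exact S.add_mem (S.add_mem (hVV v hv w hw) (hVS v hv d hd)) (S.neg_mem (hVS w hw c hc))
  let T : LieSubalgebra K L :=
    { V ⊔ S with lie_mem' := fun ha hb => Submodule.mem_sup_right (key _ ha _ hb) }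
  have hT : LieSubalgebra.lieSpan K L (Set.range x) ≤ T := by
    rw [LieSubalgebra.lieSpan_le]
    exact fun a ha => Submodule.mem_sup_left (Submodule.subset_span ha)
  rw [hx] at hT
  exact derivedSeries_one_le_iff.2 fun a b =>
    key a (hT (LieSubalgebra.mem_top a)) b (hT (LieSubalgebra.mem_top b))

end LieAlgebra

/-! ### The Lie algebra of affine maps -/

/-- The product `A × E` of a commutative ring `A` and an `A`-module `E`, regarded as the Lie algebra
`A ⋉ E` with bracket `⁅(a, v), (b, w)⁆ = (0, a • w - b • v)`. -/
def AffineLie (A : Type v) (E : Type w) : Type (max v w) := A × E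

namespace AffineLie

variable {K : Type u} {A : Type v} {E : Type w}

/-- The element `(a, v)` of `A ⋉ E`. -/
def mk (a : A) (v : E) : AffineLie A E := (a, v)

@[simp] theorem fst_mk (a : A) (v : E) : (mk a v).1 = a := rfl
@[simp] theorem snd_mk (a : A) (v : E) : (mk a v).2 = v := rfl

@[ext] theorem ext {p q : AffineLie A E} (h₁ : p.1 = q.1) (h₂ : p.2 = q.2) : p = q :=
  Prod.ext h₁ h₂

variable [CommRing K] [CommRing A] [AddCommGroup E]

instance : AddCommGroup (AffineLie A E) := inferInstanceAs (AddCommGroup (A × E))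

instance [Algebra K A] [Module K E] : Module K (AffineLie A E) := inferInstanceAs (Module K (A × E))

@[simp] theorem fst_add (p q : AffineLie A E) : (p + q).1 = p.1 + q.1 := rfl
@[simp] theorem snd_add (p q : AffineLie A E) : (p + q).2 = p.2 + q.2 := rfl
@[simp] theorem fst_zero : (0 : AffineLie A E).1 = 0 := rfl
@[simp] theorem snd_zero : (0 : AffineLie A E).2 = 0 := rfl
@[simp] theorem fst_smul [Algebra K A] [Module K E] (c : K) (p : AffineLie A E) :
    (c • p).1 = c • p.1 := rfl
@[simp] theorem snd_smul [Algebra K A] [Module K E] (c : K) (p : AffineLie A E) :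
    (c • p).2 = c • p.2 := rfl

variable [Module A E]

instance : Bracket (AffineLie A E) (AffineLie A E) :=
  ⟨fun p q => (0, p.1 • q.2 - q.1 • p.2)⟩

@[simp] theorem fst_lie (p q : AffineLie A E) : ⁅p, q⁆.1 = 0 := rfl
@[simp] theorem snd_lie (p q : AffineLie A E) : ⁅p, q⁆.2 = p.1 • q.2 - q.1 • p.2 := rfl

instance : LieRing (AffineLie A E) where
  add_lie p q r := by
    ext1
    · simp
    · simp only [snd_lie, fst_add, snd_add]; module
  lie_add p q r := by
    ext1
    · simp
    · simp only [snd_lie, fst_add, snd_add]; module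
  lie_self p := by
    ext1
    · simp
    · simp
  leibniz_lie p q r := by
    ext1
    · simp
    · simp only [snd_lie, fst_lie, snd_add]; module

instance [Algebra K A] [Module K E] [IsScalarTower K A E] : LieAlgebra K (AffineLie A E) where
  lie_smul c p q := by
    have := IsScalarTower.to_smulCommClass (R := K) (A := A) (M := E)
    ext1
    · simp
    · simp only [snd_lie, fst_smul, snd_smul, smul_sub, smul_assoc, smul_comm c p.1 q.2]

variable (K A E) in
theorem derivedSeries_two_eq_bot [Algebra K A] [Module K E] [IsScalarTower K A E] :
    LieAlgebra.derivedSeries K (AffineLie A E) 2 = ⊥ :=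
  LieAlgebra.derivedSeries_two_eq_bot_iff.2 fun _ _ _ _ => by
    ext1
    · rfl
    · simp [-lie_lie]

end AffineLie

namespace FreeMetabelianLieAlgebra

variable {K : Type u} [Field K] {X : Type v}

/-! ### The derived algebra as a module over polynomials -/

/-- The derived algebra `[F, F]` of the free metabelian Lie algebra `F`. -/
abbrev derived (K : Type u) [Field K] (X : Type v) : LieIdeal K (FreeMetabelianLieAlgebra K X) :=
  LieAlgebra.derivedSeries K (FreeMetabelianLieAlgebra K X) 1

theorem lie_eq_zero_of_mem_derived {a b : FreeMetabelianLieAlgebra K X} (ha : a ∈ derived K X)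
    (hb : b ∈ derived K X) : ⁅a, b⁆ = 0 := by
  exact LieAlgebra.lie_eq_zero_of_mem_derivedSeries_one derivedSeries_two_eq_bot ha hb

theorem toEnd_derived_commute (a b : FreeMetabelianLieAlgebra K X) :
    LieModule.toEnd K _ (derived K X) a * LieModule.toEnd K _ (derived K X) b =
      LieModule.toEnd K _ (derived K X) b * LieModule.toEnd K _ (derived K X) a := by
  ext d
  rw [← sub_eq_zero]
  have := lie_eq_zero_of_mem_derived (LieAlgebra.lie_mem_derivedSeries_one a b) d.2
  rw [lie_lie] at this
  simpa using this

/-- The action of polynomials on the derived algebra, in which the variable `X i` acts by bracketing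
with the generator `x i`. It is well defined because the derived algebra is abelian, so that these
operators commute. -/
def polyAction (K : Type u) [Field K] (X : Type v) :
    MvPolynomial X K →ₐ[K] Module.End K (derived K X) :=
  let s : Set (Module.End K (derived K X)) :=
    Set.range fun i : X => LieModule.toEnd K _ (derived K X) (x K i)
  letI : CommSemiring (Algebra.adjoin K s) :=
    { (Algebra.adjoin K s).toSemiring with
      mul_comm := (Algebra.isMulCommutative_adjoin K (by
        rintro _ ⟨i, rfl⟩ _ ⟨j, rfl⟩
        exact toEnd_derived_commute _ _)).is_comm.comm }
  (Algebra.adjoin K s).val.comp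
    (MvPolynomial.aeval fun i =>
      ⟨LieModule.toEnd K _ (derived K X) (x K i), Algebra.subset_adjoin (Set.mem_range_self i)⟩)

@[simp] theorem coe_polyAction_X (i : X) (d : derived K X) :
    (polyAction K X (.X i) d : FreeMetabelianLieAlgebra K X) = ⁅x K i, (d : FreeMetabelianLieAlgebra K X)⁆ := by
  simp [polyAction]

/-- The bracket of two generators, as an element of the derived algebra. -/
def lieX (K : Type u) [Field K] {X : Type v} (i j : X) : derived K X :=
  ⟨⁅x K i, x K j⁆, LieAlgebra.lie_mem_derivedSeries_one _ _⟩

@[simp] theorem coe_lieX (i j : X) :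
    (lieX K i j : FreeMetabelianLieAlgebra K X) = ⁅x K i, x K j⁆ := rfl

theorem lieX_skew (i j : X) : lieX K j i = -lieX K i j :=
  Subtype.ext (lie_skew _ _).symm

/-- The Jacobi identity for three generators. -/
theorem polyAction_X_lieX (i j k : X) :
    polyAction K X (.X i) (lieX K k j) - polyAction K X (.X j) (lieX K k i) =
      polyAction K X (.X k) (lieX K i j) := by
  apply Subtype.ext
  change ((polyAction K X (.X i) (lieX K k j) : derived K X) : FreeMetabelianLieAlgebra K X) -
    (polyAction K X (.X j) (lieX K k i) : derived K X) = _
  simp only [coe_polyAction_X, coe_lieX]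
  have h := lie_jacobi (x K i) (x K j) (x K k)
  rw [← lie_skew (x K j) (x K k), lie_neg] at h
  rw [sub_eq_iff_eq_add, ← sub_eq_zero, ← neg_eq_zero, ← h]
  abel

theorem lieSpan_range_x :
    LieSubalgebra.lieSpan K (FreeMetabelianLieAlgebra K X) (Set.range (x K)) = ⊤ := by
  set S := LieSubalgebra.lieSpan K (FreeMetabelianLieAlgebra K X) (Set.range (x K))
  have hS : LieAlgebra.derivedSeries K S 2 = ⊥ := by
    refine LieAlgebra.derivedSeries_two_eq_bot_iff.2 fun a b c d => Subtype.ext ?_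
    exact LieAlgebra.derivedSeries_two_eq_bot_iff.1 derivedSeries_two_eq_bot a.1 b.1 c.1 d.1
  let φ : FreeMetabelianLieAlgebra K X →ₗ⁅K⁆ S :=
    lift hS fun i => ⟨x K i, LieSubalgebra.subset_lieSpan (Set.mem_range_self i)⟩
  have h : S.incl.comp φ = LieHom.id := hom_ext fun i => by simp [φ, lift_x]
  rw [eq_top_iff]
  intro a _
  have := LieHom.congr_fun h a
  simp only [LieHom.comp_apply, LieHom.id_apply] at this
  exact this ▸ (φ a).2

/-- The inclusion of the derived algebra. -/
def derivedVal (K : Type u) [Field K] (X : Type v) :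
    derived K X →ₗ[K] FreeMetabelianLieAlgebra K X where
  toFun d := d
  map_add' _ _ := rfl
  map_smul' _ _ := rfl

theorem derivedVal_polyAction (i : X) (d : derived K X) :
    derivedVal K X (polyAction K X (.X i) d) = ⁅x K i, derivedVal K X d⁆ := coe_polyAction_X i d

theorem eq_top_of_lieX_mem {S : Submodule K (derived K X)} (h₁ : ∀ i j, lieX K i j ∈ S)
    (h₂ : ∀ i, ∀ d ∈ S, polyAction K X (.X i) d ∈ S) : S = ⊤ := by
  have h : (derived K X).toSubmodule ≤ S.map (derivedVal K X) := by
    refine LieAlgebra.derivedSeries_one_le_of_generators derivedSeries_two_eq_bot lieSpan_range_x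
      ?_ (fun i j => ⟨lieX K i j, h₁ i j, rfl⟩) ?_
    · rintro _ ⟨d, -, rfl⟩
      exact d.2
    · rintro i _ ⟨d, hd, rfl⟩
      exact ⟨polyAction K X (.X i) d, h₂ i d hd, derivedVal_polyAction i d⟩
  refine Submodule.eq_top_iff'.2 fun d => ?_
  obtain ⟨d', hd', hd⟩ := h d.2
  have : d' = d := Subtype.ext hd
  rw [← this]
  exact hd'

/-- The derived algebra is generated, as a module over polynomials, by the brackets of two
generators. -/
theorem span_polyAction_lieX :
    Submodule.span K {d | ∃ p i j, polyAction K X p (lieX K i j) = d} = ⊤ := by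
  set S := Submodule.span K {d | ∃ p i j, polyAction K X p (lieX K i j) = d}
  refine eq_top_of_lieX_mem ?_ ?_
  · exact fun i j => Submodule.subset_span ⟨1, i, j, by rw [_root_.map_one, Module.End.one_apply]⟩
  · rintro i d hd
    induction hd using Submodule.span_induction with
    | mem d hd =>
      obtain ⟨p, j, k, rfl⟩ := hd
      refine Submodule.subset_span ⟨.X i * p, j, k, ?_⟩
      rw [_root_.map_mul, Module.End.mul_apply]
    | zero => rw [_root_.map_zero]; exact S.zero_mem
    | add v w _ _ hv hw => rw [map_add]; exact S.add_mem hv hw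
    | smul c v _ hv => rw [map_smul]; exact S.smul_mem c hv

/-- Every element of the free metabelian Lie algebra is the sum of a linear combination of the
generators and an element of the derived algebra. -/
theorem exists_incl_add (a : FreeMetabelianLieAlgebra K X) :
    ∃ v, ∃ d : derived K X, a = incl K X v + d := by
  let S : LieSubalgebra K (FreeMetabelianLieAlgebra K X) :=
    { LinearMap.range (incl K X) ⊔ (derived K X).toSubmodule with
      lie_mem' := fun _ _ => Submodule.mem_sup_right (LieAlgebra.lie_mem_derivedSeries_one _ _) }
  have hS : LieSubalgebra.lieSpan K _ (Set.range (x K)) ≤ S := by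
    rw [LieSubalgebra.lieSpan_le]
    rintro _ ⟨i, rfl⟩
    exact Submodule.mem_sup_left ⟨Finsupp.single i 1, by simp [incl]⟩
  rw [lieSpan_range_x] at hS
  obtain ⟨_, ⟨v, rfl⟩, d, hd, h⟩ := Submodule.mem_sup.1 (hS (LieSubalgebra.mem_top a))
  exact ⟨v, ⟨d, hd⟩, h.symm⟩

/-! ### The Magnus map -/

section Magnus

variable [DecidableEq X]

/-- The Magnus map, from the free metabelian Lie algebra to `A ⋉ A ^ X` with `A = K[X]`: it sends
the generator `x i` to the pair of the variable `X i` and the basis vector `e i`. -/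
def magnus (K : Type u) [Field K] (X : Type v) [DecidableEq X] :
    FreeMetabelianLieAlgebra K X →ₗ⁅K⁆ AffineLie (MvPolynomial X K) (X → MvPolynomial X K) :=
  lift (AffineLie.derivedSeries_two_eq_bot K _ _) fun i => .mk (.X i) (Pi.single i 1)

@[simp] theorem magnus_x (i : X) : magnus K X (x K i) = .mk (.X i) (Pi.single i 1) := lift_x _ _ i

theorem fst_magnus_derived (d : derived K X) : (magnus K X d).1 = 0 := by
  let φ : FreeMetabelianLieAlgebra K X →ₗ[K] MvPolynomial X K :=
    { toFun a := (magnus K X a).1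
      map_add' a b := by simp
      map_smul' c a := by simp }
  refine (LieAlgebra.derivedSeries_one_le_iff (S := LinearMap.ker φ)).2 (fun a b => ?_) d.2
  change (magnus K X ⁅a, b⁆).1 = 0
  rw [LieHom.map_lie, AffineLie.fst_lie]

/-- The Magnus map on the derived algebra, with values in `A ^ X`. -/
def magnusDerived (K : Type u) [Field K] (X : Type v) [DecidableEq X] :
    derived K X →ₗ[K] X → MvPolynomial X K where
  toFun d := (magnus K X d).2
  map_add' a b := by simp
  map_smul' c a := by simp

theorem magnusDerived_polyAction (p : MvPolynomial X K) (d : derived K X) :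
    magnusDerived K X (polyAction K X p d) = p • magnusDerived K X d := by
  induction p using MvPolynomial.induction_on generalizing d with
  | C c =>
    rw [← MvPolynomial.algebraMap_eq, AlgHom.commutes, algebraMap_smul]
    simp
  | add p q hp hq => simp [hp, hq, add_smul]
  | mul_X p i hp =>
    rw [_root_.map_mul, Module.End.mul_apply, hp, mul_smul]
    congr 1
    change (magnus K X (polyAction K X (.X i) d : derived K X)).2 = _
    rw [coe_polyAction_X, LieHom.map_lie, AffineLie.snd_lie, fst_magnus_derived, zero_smul,
      sub_zero, magnus_x]
    rfl

theorem magnusDerived_lieX (i j : X) :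
    magnusDerived K X (lieX K i j) = Pi.single j (.X i) - Pi.single i (.X j) := by
  change (magnus K X (lieX K i j : derived K X)).2 = _
  rw [coe_lieX, LieHom.map_lie, AffineLie.snd_lie, magnus_x, magnus_x]
  simp [← Pi.single_smul']

end Magnus

/-! ### Linear substitutions -/

section Substitution

variable [Fintype X]

/-- The substitution `X i ↦ T (X i)` on polynomials. -/
def linSubst (T : (X →₀ K) →ₗ[K] (X →₀ K)) : MvPolynomial X K →ₐ[K] MvPolynomial X K :=
  MvPolynomial.aeval fun i => ∑ k, MvPolynomial.C (T (Finsupp.single i 1) k) * .X k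

/-- The diagonal action of a linear map `T` of `KX` on `A ^ X = A ⊗ KX`. -/
def linAct (T : (X →₀ K) →ₗ[K] (X →₀ K)) :
    (X → MvPolynomial X K) →ₗ[K] (X → MvPolynomial X K) where
  toFun m k := ∑ j, linSubst T (m j) * .C (T (Finsupp.single j 1) k)
  map_add' a b := by
    ext1 k
    simp [add_mul, Finset.sum_add_distrib]
  map_smul' c a := by
    ext1 k
    simp [Finset.smul_sum]

theorem linAct_smul (T : (X →₀ K) →ₗ[K] (X →₀ K)) (p : MvPolynomial X K)
    (m : X → MvPolynomial X K) : linAct T (p • m) = linSubst T p • linAct T m := by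
  ext1 k
  simp [linAct, Finset.mul_sum, mul_assoc]

/-- The diagonal action of a linear map of `KX` on `A ⋉ A ^ X`. -/
def affineAct (T : (X →₀ K) →ₗ[K] (X →₀ K)) :
    AffineLie (MvPolynomial X K) (X → MvPolynomial X K) →ₗ⁅K⁆
      AffineLie (MvPolynomial X K) (X → MvPolynomial X K) where
  toFun p := .mk (linSubst T p.1) (linAct T p.2)
  map_add' p q := AffineLie.ext (map_add (linSubst T) p.1 q.1) (map_add (linAct T) p.2 q.2)
  map_smul' c p := AffineLie.ext (map_smul (linSubst T) c p.1) (map_smul (linAct T) c p.2)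
  map_lie' {p q} := by
    ext1
    · exact map_zero (linSubst T)
    · change linAct T (p.1 • q.2 - q.1 • p.2) = _
      rw [map_sub, linAct_smul, linAct_smul]
      rfl

theorem fst_affineAct (T : (X →₀ K) →ₗ[K] (X →₀ K))
    (p : AffineLie (MvPolynomial X K) (X → MvPolynomial X K)) :
    (affineAct T p).1 = linSubst T p.1 := rfl

theorem snd_affineAct (T : (X →₀ K) →ₗ[K] (X →₀ K))
    (p : AffineLie (MvPolynomial X K) (X → MvPolynomial X K)) :
    (affineAct T p).2 = linAct T p.2 := rfl

variable [DecidableEq X]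

theorem magnus_incl (v : X →₀ K) :
    magnus K X (incl K X v) = .mk (∑ k, .C (v k) * .X k) fun k => .C (v k) := by
  induction v using Finsupp.induction_linear with
  | zero =>
    rw [_root_.map_zero, _root_.map_zero]
    ext1
    · simp
    · ext1 k; simp
  | add v w hv hw =>
    rw [map_add, map_add, hv, hw]
    ext1
    · simp [add_mul, Finset.sum_add_distrib]
    · ext1 k
      simp
  | single i c =>
    rw [incl, Finsupp.linearCombination_single, map_smul, magnus_x]
    ext1
    · simp [Finsupp.single_apply, apply_ite MvPolynomial.C, MvPolynomial.smul_eq_C_mul]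
    · ext1 k
      simp [Finsupp.single_apply, Pi.single_apply, apply_ite MvPolynomial.C,
        MvPolynomial.smul_eq_C_mul, eq_comm]

/-- The Magnus map is equivariant. -/
theorem magnus_map (T : (X →₀ K) →ₗ[K] (X →₀ K)) (a : FreeMetabelianLieAlgebra K X) :
    magnus K X (map T a) = affineAct T (magnus K X a) := by
  have h : (magnus K X).comp (map T) = (affineAct T).comp (magnus K X) := hom_ext fun i => by
    rw [LieHom.comp_apply, LieHom.comp_apply, map_x, magnus_incl, magnus_x]
    ext1
    · rw [fst_affineAct]
      simp [linSubst]
    · ext1 k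
      rw [snd_affineAct]
      simp [linAct, Pi.single_apply, apply_ite (linSubst T)]
  exact LieHom.congr_fun h a

end Substitution

/-! ### The retraction of the Magnus map -/

/-- The linear operator on polynomials dividing each monomial `m` by `deg m + 1`. -/
def divDegreeSucc (K : Type u) [Field K] (X : Type v) : MvPolynomial X K →ₗ[K] MvPolynomial X K :=
  (MvPolynomial.basisMonomials X K).constr K fun α =>
    MvPolynomial.monomial α ((α.degree + 1 : K)⁻¹)

theorem divDegreeSucc_monomial (α : X →₀ ℕ) (c : K) :
    divDegreeSucc K X (.monomial α c) = .monomial α (c * (α.degree + 1 : K)⁻¹) := by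
  have h := (MvPolynomial.basisMonomials X K).constr_basis K
    (fun α => MvPolynomial.monomial α ((α.degree + 1 : K)⁻¹)) α
  rw [MvPolynomial.coe_basisMonomials] at h
  have hc : MvPolynomial.monomial α c = c • MvPolynomial.monomial α (1 : K) := by
    rw [MvPolynomial.smul_monomial, smul_eq_mul, mul_one]
  rw [hc, map_smul, divDegreeSucc, h, MvPolynomial.smul_monomial, smul_eq_mul]

theorem divDegreeSucc_monomial_mul_X (α : X →₀ ℕ) (c : K) (i : X) :
    divDegreeSucc K X (.monomial α c * .X i) =
      (α.degree + 2 : K)⁻¹ • (.monomial α c * .X i) := by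
  rw [MvPolynomial.X, MvPolynomial.monomial_mul, mul_one, divDegreeSucc_monomial,
    MvPolynomial.smul_monomial, map_add, Finsupp.degree_single, smul_eq_mul, mul_comm]
  congr 3
  push_cast
  ring

variable [Fintype X]

/-- The Koszul contraction `A ^ X → [F, F]`, which sends `f e_j` to `∑ k, ∂_k f' • ⁅x k, x j⁆`,
where `f'` is obtained from `f` by dividing each monomial by its degree plus one. The division makes
it a left inverse of the Magnus map. -/
def contraction (K : Type u) [Field K] (X : Type v) [Fintype X] :
    (X → MvPolynomial X K) →ₗ[K] derived K X where
  toFun m := ∑ j, ∑ k, polyAction K X (.pderiv k (divDegreeSucc K X (m j))) (lieX K k j)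
  map_add' a b := by simp [Finset.sum_add_distrib]
  map_smul' c a := by simp [Finset.smul_sum]

theorem contraction_apply (m : X → MvPolynomial X K) : contraction K X m =
    ∑ j, ∑ k, polyAction K X (.pderiv k (divDegreeSucc K X (m j))) (lieX K k j) := rfl

variable [DecidableEq X]

theorem contraction_single (j : X) (p : MvPolynomial X K) : contraction K X (Pi.single j p) =
    ∑ k, polyAction K X (.pderiv k (divDegreeSucc K X p)) (lieX K k j) := by
  rw [contraction_apply, Finset.sum_eq_single j]
  · simp
  · intro i _ hi
    simp [hi]
  · simp

theorem sum_pderiv_mul_X (p : MvPolynomial X K) (i j : X) :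
    ∑ k, polyAction K X (.pderiv k (p * .X i)) (lieX K k j) =
      polyAction K X p (lieX K i j) +
        ∑ k, polyAction K X (.pderiv k p) (polyAction K X (.X i) (lieX K k j)) := by
  simp only [Derivation.leibniz, smul_eq_mul, MvPolynomial.pderiv_X, map_add, _root_.map_mul,
    LinearMap.add_apply, Finset.sum_add_distrib, Module.End.mul_apply]
  congr 1
  · rw [Finset.sum_eq_single i]
    · simp
    · intro k _ hk
      simp [hk]
    · simp
  · refine Finset.sum_congr rfl fun k _ => ?_
    rw [← Module.End.mul_apply, ← _root_.map_mul, mul_comm, _root_.map_mul, Module.End.mul_apply]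

variable [CharZero K]

/-- The contraction inverts the Magnus map on module generators, by Euler's identity for homogeneous
polynomials and the Jacobi identity. -/
theorem contraction_lieX (p : MvPolynomial X K) (i j : X) :
    contraction K X (p • (Pi.single j (.X i) - Pi.single i (.X j))) =
      polyAction K X p (lieX K i j) := by
  induction p using MvPolynomial.induction_on' with
  | add p q hp hq => rw [add_smul, map_add, hp, hq, map_add, LinearMap.add_apply]
  | monomial α c =>
    set b := MvPolynomial.monomial α c
    have hE : ∑ k, MvPolynomial.X k * MvPolynomial.pderiv k b = α.degree • b :=
      (MvPolynomial.isHomogeneous_monomial c rfl).sum_X_mul_pderiv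
    have hE' : ∑ k, polyAction K X (.pderiv k b) (polyAction K X (.X k) (lieX K i j)) =
        α.degree • polyAction K X b (lieX K i j) := by
      rw [← LinearMap.smul_apply, ← map_nsmul, ← hE, map_sum, LinearMap.sum_apply]
      refine Finset.sum_congr rfl fun k _ => ?_
      rw [mul_comm, _root_.map_mul, Module.End.mul_apply]
    have h0 : (α.degree + 2 : K) ≠ 0 := by exact_mod_cast (α.degree + 1).succ_ne_zero
    rw [smul_sub, map_sub, ← Pi.single_smul', ← Pi.single_smul', contraction_single,
      contraction_single, smul_eq_mul, smul_eq_mul, divDegreeSucc_monomial_mul_X,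
      divDegreeSucc_monomial_mul_X]
    simp only [Derivation.map_smul, map_smul, LinearMap.smul_apply, ← Finset.smul_sum, ← smul_sub]
    rw [inv_smul_eq_iff₀ h0, sum_pderiv_mul_X, sum_pderiv_mul_X, add_sub_add_comm,
      ← Finset.sum_sub_distrib]
    simp only [← map_sub, polyAction_X_lieX]
    rw [hE', lieX_skew i j, sub_neg_eq_add, map_add, ← Nat.cast_smul_eq_nsmul K]
    module

/-- The contraction is a left inverse of the Magnus map on the derived algebra; in particular the Magnus
map is injective there. -/
theorem contraction_magnusDerived (d : derived K X) :
    contraction K X (magnusDerived K X d) = d := by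
  have h : contraction K X ∘ₗ magnusDerived K X = LinearMap.id := by
    refine LinearMap.ext_on span_polyAction_lieX ?_
    rintro _ ⟨p, i, j, rfl⟩
    simp [magnusDerived_polyAction, magnusDerived_lieX, contraction_lieX]
  exact LinearMap.congr_fun h d

end FreeMetabelianLieAlgebra

/-! ### Coefficients of substituted polynomials -/

namespace MvPolynomial

variable {R : Type u} [CommSemiring R] {σ : Type v} {τ : Type w}

theorem coeff_aeval_C_mul_X (t : σ → R) (p : MvPolynomial σ R) (α : σ →₀ ℕ) :
    coeff α (aeval (fun i => C (t i) * X i : σ → MvPolynomial σ R) p) =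
      coeff α p * α.prod fun i k => t i ^ k := by
  classical
  induction p using MvPolynomial.induction_on' with
  | add p q hp hq => rw [map_add, coeff_add, hp, hq, coeff_add, add_mul]
  | monomial β c =>
    have h : aeval (fun i => C (t i) * X i : σ → MvPolynomial σ R) (monomial β c) =
        monomial β (c * β.prod fun i k => t i ^ k) := by
      rw [aeval_monomial, monomial_eq (s := β), map_mul]
      simp only [mul_pow, Finsupp.prod_mul, algebraMap_eq, ← mul_assoc]
      simp [Finsupp.prod, map_prod]
    rw [h, coeff_monomial, coeff_monomial]
    split_ifs with hβ
    · rw [hβ]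
    · rw [zero_mul]

theorem coeff_aeval_update_X_zero [DecidableEq σ] (i : σ) (p : MvPolynomial σ R) (α : σ →₀ ℕ) :
    coeff α (aeval (Function.update X i 0 : σ → MvPolynomial σ R) p) =
      if α i = 0 then coeff α p else 0 := by
  induction p using MvPolynomial.induction_on' with
  | add p q hp hq => rw [map_add, coeff_add, hp, hq, coeff_add]; split_ifs <;> simp
  | monomial β c =>
    by_cases hβ : β i = 0
    · have h : aeval (Function.update X i 0 : σ → MvPolynomial σ R) (monomial β c) =
          monomial β c := by
        rw [aeval_monomial, monomial_eq (s := β), algebraMap_eq]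
        congr 1
        refine Finset.prod_congr rfl fun j hj => ?_
        dsimp only
        rw [Function.update_of_ne]
        rintro rfl
        exact Finsupp.mem_support_iff.1 hj hβ
      rw [h, coeff_monomial]
      split_ifs <;> simp_all
    · have h : aeval (Function.update X i 0 : σ → MvPolynomial σ R) (monomial β c) = 0 := by
        rw [aeval_monomial, Finsupp.prod, Finset.prod_eq_zero (Finsupp.mem_support_iff.2 hβ),
          mul_zero]
        simp [hβ]
      rw [h, coeff_monomial, coeff_zero]
      split_ifs <;> simp_all

theorem coeff_rename_of_injOn {f : σ → τ} {s : Set (σ →₀ ℕ)}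
    (hf : Set.InjOn (Finsupp.mapDomain f) s) {p : MvPolynomial σ R} (hp : ↑p.support ⊆ s)
    {α : σ →₀ ℕ} (hα : α ∈ s) : coeff (α.mapDomain f) (rename f p) = coeff α p := by
  classical
  conv_lhs => rw [p.as_sum, map_sum, coeff_sum]
  simp only [rename_monomial, coeff_monomial]
  rw [Finset.sum_eq_single α]
  · simp
  · intro β hβ hne
    rw [if_neg fun h => hne (hf (hp hβ) hα h)]
  · intro h
    simpa using h

/-- A renaming of variables that merges some of them is still injective on polynomials whose exponents
lie in a set on which it is injective. -/
theorem rename_injOn {f : σ → τ} {s : Set (σ →₀ ℕ)} (hf : Set.InjOn (Finsupp.mapDomain f) s) :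
    Set.InjOn (rename f : MvPolynomial σ R → MvPolynomial τ R) {p | ↑p.support ⊆ s} := by
  intro p hp q hq h
  ext α
  by_cases hα : α ∈ s
  · rw [← coeff_rename_of_injOn hf hp hα, h, coeff_rename_of_injOn hf hq hα]
  · rw [notMem_support_iff.1 fun h => hα (hp h), notMem_support_iff.1 fun h => hα (hq h)]

end MvPolynomial

namespace FreeMetabelianLieAlgebra

variable {K : Type u} [Field K] {n : ℕ}

open MvPolynomial (C coeff monomial rename aeval)

/-! ### Invariants of a torus element and a transvection -/

/-- `T` is the diagonal map with eigenvalues `2, 1/2, 1, …, 1`. -/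
structure IsTorus (T : (Fin (n + 2) →₀ K) →ₗ[K] (Fin (n + 2) →₀ K)) : Prop where
  zero : T (Finsupp.single 0 1) = Finsupp.single 0 2
  one : T (Finsupp.single 1 1) = Finsupp.single 1 2⁻¹
  succ (i : Fin n) : T (Finsupp.single i.succ.succ 1) = Finsupp.single i.succ.succ 1

/-- `T` is the transvection which maps `x_1` to `x_0 + x_1` and fixes all other basis vectors. -/
structure IsTransvection (T : (Fin (n + 2) →₀ K) →ₗ[K] (Fin (n + 2) →₀ K)) : Prop where
  zero : T (Finsupp.single 0 1) = Finsupp.single 0 1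
  one : T (Finsupp.single 1 1) = Finsupp.single 0 1 + Finsupp.single 1 1
  succ (i : Fin n) : T (Finsupp.single i.succ.succ 1) = Finsupp.single i.succ.succ 1

variable {T : (Fin (n + 2) →₀ K) →ₗ[K] (Fin (n + 2) →₀ K)}

/-- The eigenvalues `2, 1/2, 1, …, 1`. -/
def torusWeight (K : Type u) [Field K] (n : ℕ) : Fin (n + 2) → K :=
  Fin.cons 2 (Fin.cons 2⁻¹ 1)

theorem IsTorus.apply (hT : IsTorus T) (i : Fin (n + 2)) :
    T (Finsupp.single i 1) = Finsupp.single i (torusWeight K n i) := by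
  refine Fin.cases hT.zero (fun i => Fin.cases hT.one (fun i => ?_) i) i
  rw [hT.succ]
  rfl

theorem IsTorus.coeff_linSubst (hT : IsTorus T) (p : MvPolynomial (Fin (n + 2)) K)
    (α : Fin (n + 2) →₀ ℕ) : coeff α (linSubst T p) = coeff α p * (2 ^ α 0 * 2⁻¹ ^ α 1) := by
  have h : linSubst T = aeval fun i => C (torusWeight K n i) * .X i := by
    ext1 i
    simp [linSubst, hT.apply, Finsupp.single_apply, apply_ite (C : K → MvPolynomial _ K)]
  rw [h, MvPolynomial.coeff_aeval_C_mul_X, Finsupp.prod_fintype _ _ (by simp), Fin.prod_univ_succ,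
    Fin.prod_univ_succ]
  simp [torusWeight]

theorem IsTorus.linAct_apply (hT : IsTorus T) (m : Fin (n + 2) → MvPolynomial (Fin (n + 2)) K)
    (k : Fin (n + 2)) : linAct T m k = linSubst T (m k) * C (torusWeight K n k) := by
  simp [linAct, hT.apply, Finsupp.single_apply, apply_ite (C : K → MvPolynomial _ K)]

/-- Each monomial occurring in an invariant of `A ^ X` has eigenvalue one. -/
theorem IsTorus.coeff_mul (hT : IsTorus T) {m : Fin (n + 2) → MvPolynomial (Fin (n + 2)) K}
    (hm : linAct T m = m) {k : Fin (n + 2)} {α : Fin (n + 2) →₀ ℕ} (hα : α ∈ (m k).support) :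
    2 ^ α 0 * 2⁻¹ ^ α 1 * torusWeight K n k = 1 := by
  have h := congrArg (coeff α) (congrFun hm k)
  rw [hT.linAct_apply, mul_comm, MvPolynomial.coeff_C_mul, hT.coeff_linSubst, mul_comm,
    mul_assoc] at h
  exact (mul_eq_left₀ (MvPolynomial.mem_support_iff.1 hα)).1 h

section CharZero

variable [CharZero K]

theorem two_pow_mul_inv_two_pow_eq_one {a b : ℕ} (h : (2 : K) ^ a * 2⁻¹ ^ b = 1) : a = b := by
  rw [inv_pow, mul_inv_eq_one₀ (pow_ne_zero b two_ne_zero)] at h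
  exact Nat.pow_right_injective le_rfl (by exact_mod_cast h)

theorem IsTorus.support_zero (hT : IsTorus T) {m : Fin (n + 2) → MvPolynomial (Fin (n + 2)) K}
    (hm : linAct T m = m) {α : Fin (n + 2) →₀ ℕ} (hα : α ∈ (m 0).support) : α 1 = α 0 + 1 := by
  refine (two_pow_mul_inv_two_pow_eq_one (K := K) ?_).symm
  rw [← hT.coeff_mul hm hα, torusWeight, Fin.cons_zero]
  ring

theorem IsTorus.support_one (hT : IsTorus T) {m : Fin (n + 2) → MvPolynomial (Fin (n + 2)) K}
    (hm : linAct T m = m) {α : Fin (n + 2) →₀ ℕ} (hα : α ∈ (m 1).support) : α 0 = α 1 + 1 := by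
  refine two_pow_mul_inv_two_pow_eq_one (K := K) ?_
  have h : torusWeight K n 1 = 2⁻¹ := rfl
  rw [← hT.coeff_mul hm hα, h]
  ring

theorem IsTorus.support_succ (hT : IsTorus T) {m : Fin (n + 2) → MvPolynomial (Fin (n + 2)) K}
    (hm : linAct T m = m) (i : Fin n) {α : Fin (n + 2) →₀ ℕ} (hα : α ∈ (m i.succ.succ).support) :
    α 0 = α 1 := by
  refine two_pow_mul_inv_two_pow_eq_one (K := K) ?_
  have h : torusWeight K n i.succ.succ = 1 := rfl
  rw [← hT.coeff_mul hm hα, h, mul_one]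

end CharZero

theorem succ_succ_ne_one (i : Fin n) : i.succ.succ ≠ 1 := by simp [Fin.ext_iff]

/-- The map of indices that merges `1` into `0`. -/
def merge (n : ℕ) (i : Fin (n + 2)) : Fin (n + 2) := if i = 1 then 0 else i

theorem mapDomain_merge (α : Fin (n + 2) →₀ ℕ) (i : Fin (n + 2)) :
    α.mapDomain (merge n) i = if i = 0 then α 0 + α 1 else if i = 1 then 0 else α i := by
  rw [Finsupp.mapDomain, Finsupp.sum_fintype _ _ (by simp), Finsupp.finsetSum_apply,
    Fin.sum_univ_succ, Fin.sum_univ_succ]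
  have h0 : merge n 0 = 0 := rfl
  have h1 : merge n 1 = 0 := rfl
  have h2 (j : Fin n) : merge n j.succ.succ = j.succ.succ := if_neg (succ_succ_ne_one j)
  simp only [Fin.succ_zero_eq_one, h0, h1, h2]
  refine Fin.cases ?_ (fun i => Fin.cases ?_ (fun i => ?_) i) i
  · simp
  · simp [succ_succ_ne_one]
  · simp [Finsupp.single_apply, succ_succ_ne_one]

/-- Merging two variables loses no information about monomials whose two exponents differ by a
fixed amount. -/
theorem mapDomain_merge_injOn (a b : ℕ) :
    Set.InjOn (Finsupp.mapDomain (merge n)) {α : Fin (n + 2) →₀ ℕ | α 0 + a = α 1 + b} := by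
  intro α hα β hβ h
  have h' := fun i => DFunLike.congr_fun h i
  simp only [mapDomain_merge] at h'
  have h0 := h' 0
  simp only [if_true] at h0
  simp only [Set.mem_ofPred_eq] at hα hβ
  ext i
  by_cases hi0 : i = 0
  · subst hi0; omega
  by_cases hi1 : i = 1
  · subst hi1; omega
  simpa [hi0, hi1] using h' i

/-- Applying the transvection and then setting `X 1 = 0` amounts to setting `X 1 = X 0`. -/
theorem IsTransvection.aeval_linSubst (hT : IsTransvection T)
    (p : MvPolynomial (Fin (n + 2)) K) :
    aeval (Function.update MvPolynomial.X 1 0 : _ → MvPolynomial (Fin (n + 2)) K) (linSubst T p) =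
      rename (merge n) p := by
  have h : (aeval (Function.update MvPolynomial.X 1 0 : _ → MvPolynomial (Fin (n + 2)) K)).comp
      (linSubst T) = rename (merge n) := by
    ext1 i
    rw [AlgHom.comp_apply]
    refine Fin.cases ?_ (fun i => Fin.cases ?_ (fun i => ?_) i) i
    · simp [linSubst, hT.zero, merge, Finsupp.single_apply, apply_ite (C : K → MvPolynomial _ K)]
    · simp [linSubst, hT.one, merge, Finsupp.single_apply, apply_ite (C : K → MvPolynomial _ K), add_mul,
        Finset.sum_add_distrib]
    · simp [linSubst, hT.succ, merge, succ_succ_ne_one, Finsupp.single_apply,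
        apply_ite (C : K → MvPolynomial _ K)]
  exact DFunLike.congr_fun h p

theorem IsTransvection.linAct_zero (hT : IsTransvection T)
    (m : Fin (n + 2) → MvPolynomial (Fin (n + 2)) K) :
    linAct T m 0 = linSubst T (m 0) + linSubst T (m 1) := by
  simp [linAct, Fin.sum_univ_succ, hT.zero, hT.one, hT.succ]

theorem IsTransvection.linAct_succ (hT : IsTransvection T)
    (m : Fin (n + 2) → MvPolynomial (Fin (n + 2)) K) (i : Fin (n + 1)) :
    linAct T m i.succ = linSubst T (m i.succ) := by
  refine Fin.cases ?_ (fun i => ?_) i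
  · simp [linAct, Fin.sum_univ_succ, hT.zero, hT.one, hT.succ, succ_succ_ne_one]
  · simp [linAct, Fin.sum_univ_succ, hT.zero, hT.one, hT.succ, Finsupp.single_apply,
      apply_ite (C : K → MvPolynomial _ K), (succ_succ_ne_one i).symm, (Fin.succ_ne_zero _).symm]

section Invariants

variable [CharZero K] {S T : (Fin (n + 2) →₀ K) →ₗ[K] (Fin (n + 2) →₀ K)} (hS : IsTorus S)
  (hT : IsTransvection T) {m : Fin (n + 2) → MvPolynomial (Fin (n + 2)) K} (hmS : linAct S m = m)
  (hmT : linAct T m = m)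

include hT hmT in
omit [CharZero K] in
/-- For an invariant component `p`, setting `X 1 = X 0` and setting `X 1 = 0` give the same
polynomial. As the exponents of `X 0` and `X 1` differ by a constant, merging these variables causes
no cancellation, so that `p` is free of `X 1`. -/
theorem apply_one_eq_zero_of_mem_support (i : Fin (n + 1)) {a : ℕ}
    (ha : ∀ α ∈ (m i.succ).support, α 0 = α 1 + a) {α : Fin (n + 2) →₀ ℕ}
    (hα : α ∈ (m i.succ).support) : α 1 = 0 := by
  have h := hT.aeval_linSubst (m i.succ)
  rw [← hT.linAct_succ, hmT] at h
  have h' := MvPolynomial.coeff_rename_of_injOn (mapDomain_merge_injOn (n := n) 0 a)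
    (p := m i.succ) (fun α hα => ha α hα) (ha α hα)
  rw [← h, MvPolynomial.coeff_aeval_update_X_zero, if_pos (by simp [mapDomain_merge])] at h'
  have hβ : α.mapDomain (merge n) ∈ (m i.succ).support := by
    rw [MvPolynomial.mem_support_iff, h']
    exact MvPolynomial.mem_support_iff.1 hα
  have h0 := ha _ hβ
  have h1 := ha _ hα
  simp only [mapDomain_merge, if_true, one_ne_zero, if_false] at h0
  omega

include hS hT hmS hmT

theorem support_one_of_invariant {α : Fin (n + 2) →₀ ℕ} (hα : α ∈ (m 1).support) :
    α 0 = 1 ∧ α 1 = 0 := by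
  have h1 := apply_one_eq_zero_of_mem_support hT hmT 0
    (fun α hα => hS.support_one hmS hα) hα
  exact ⟨by rw [hS.support_one hmS hα, h1], h1⟩

theorem support_succ_of_invariant (i : Fin n) {α : Fin (n + 2) →₀ ℕ}
    (hα : α ∈ (m i.succ.succ).support) : α 0 = 0 ∧ α 1 = 0 := by
  have h1 := apply_one_eq_zero_of_mem_support hT hmT i.succ (a := 0)
    (fun α hα => hS.support_succ hmS i hα) hα
  exact ⟨by rw [hS.support_succ hmS i hα, h1], h1⟩

/-- The two components of an invariant along the plane are determined by each other: together they
form a multiple of the Koszul element `X 0 • e_1 - X 1 • e_0`. -/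
theorem apply_zero_of_invariant : m 0 = -rename (Equiv.swap 0 1) (m 1) := by
  have h : aeval (Function.update MvPolynomial.X 1 0 : _ → MvPolynomial (Fin (n + 2)) K) (m 0) =
      rename (merge n) (m 0) + rename (merge n) (m 1) := by
    conv_lhs => rw [← hmT, hT.linAct_zero, map_add, hT.aeval_linSubst, hT.aeval_linSubst]
  have h0 : aeval (Function.update MvPolynomial.X 1 0 : _ → MvPolynomial (Fin (n + 2)) K) (m 0) =
      0 := by
    ext α
    rw [MvPolynomial.coeff_aeval_update_X_zero, MvPolynomial.coeff_zero, ite_eq_right_iff]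
    intro hα
    by_contra h
    have := hS.support_zero hmS (MvPolynomial.mem_support_iff.2 h)
    omega
  have hmerge : merge n ∘ Equiv.swap 0 1 = merge n := by
    ext1 i
    refine Fin.cases ?_ (fun i => Fin.cases ?_ (fun i => ?_) i) i
    · simp [merge]
    · simp [merge]
    · rw [Function.comp_apply, Equiv.swap_apply_of_ne_of_ne] <;> simp [Fin.ext_iff]
  -- Both sides have exponents with `α 0 + 1 = α 1`, and agree after the substitution `X 1 = X 0`.
  refine MvPolynomial.rename_injOn (mapDomain_merge_injOn (n := n) 1 0)
    (fun α hα => (hS.support_zero hmS hα).symm) ?_ ?_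
  · intro α hα
    rw [MvPolynomial.support_neg, MvPolynomial.support_rename_of_injective (Equiv.injective _),
      Finset.coe_image] at hα
    obtain ⟨β, hβ, rfl⟩ := hα
    have := support_one_of_invariant hS hT hmS hmT hβ
    simp only [Set.mem_ofPred_eq]
    have e0 := Finsupp.mapDomain_apply (Equiv.swap (0 : Fin (n + 2)) 1).injective β 0
    have e1 := Finsupp.mapDomain_apply (Equiv.swap (0 : Fin (n + 2)) 1).injective β 1
    rw [Equiv.swap_apply_left] at e0
    rw [Equiv.swap_apply_right] at e1
    rw [e0, e1]
    omega
  · rw [map_neg, MvPolynomial.rename_rename, hmerge, eq_neg_iff_add_eq_zero, ← h, h0]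

end Invariants

end FreeMetabelianLieAlgebra

namespace FreeMetabelianLieAlgebra

/-! ### Invariants lie in the subalgebra -/

theorem polyAction_monomial_mem {K : Type u} [Field K] {X : Type v} {N : Submodule K (derived K X)}
    {α : X →₀ ℕ} (hN : ∀ i ∈ α.support, ∀ d ∈ N, polyAction K X (.X i) d ∈ N) (c : K)
    {d : derived K X} (hd : d ∈ N) : polyAction K X (.monomial α c) d ∈ N := by
  let S : Subalgebra K (MvPolynomial X K) :=
    { carrier := {p | ∀ d ∈ N, polyAction K X p d ∈ N}
      mul_mem' := fun {p q} hp hq d hd => by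
        rw [_root_.map_mul, Module.End.mul_apply]
        exact hp _ (hq d hd)
      add_mem' := fun {p q} hp hq d hd => by
        rw [map_add, LinearMap.add_apply]
        exact N.add_mem (hp d hd) (hq d hd)
      algebraMap_mem' := fun c d hd => by
        rw [AlgHom.commutes, Module.algebraMap_end_apply]
        exact N.smul_mem c hd }
  have h : MvPolynomial.monomial α c ∈ S := by
    rw [MvPolynomial.monomial_eq]
    exact S.mul_mem (S.algebraMap_mem c) (S.prod_mem fun i hi => S.pow_mem (hN i hi) _)
  exact h d hd

variable {K : Type u} [Field K] {n : ℕ}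

theorem eq_zero_or_one_or_succ_succ (i : Fin (n + 2)) :
    i = 0 ∨ i = 1 ∨ ∃ j : Fin n, i = j.succ.succ :=
  Fin.cases (Or.inl rfl) (fun i => Fin.cases (Or.inr (Or.inl rfl))
    (fun j => Or.inr (Or.inr ⟨j, rfl⟩)) i) i

variable {L : LieSubalgebra K (FreeMetabelianLieAlgebra K (Fin (n + 2)))}
  (hL : ⁅x K (1 : Fin (n + 2)), x K (0 : Fin (n + 2))⁆ ∈ L) (hx : ∀ i : Fin n, x K i.succ.succ ∈ L)

include hx in
/-- A subalgebra containing `x i` for `i ≥ 2` is stable under monomials in these variables. -/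
theorem polyAction_monomial_mem_subalgebra {α : Fin (n + 2) →₀ ℕ} (h0 : α 0 = 0) (h1 : α 1 = 0)
    (c : K) {d : derived K (Fin (n + 2))} (hd : derivedVal K _ d ∈ L) :
    derivedVal K _ (polyAction K _ (.monomial α c) d) ∈ L := by
  refine polyAction_monomial_mem (N := L.toSubmodule.comap (derivedVal K _)) (fun i hi d hd => ?_)
    c hd
  obtain rfl | rfl | ⟨j, rfl⟩ := eq_zero_or_one_or_succ_succ i
  · exact absurd h0 (Finsupp.mem_support_iff.1 hi)
  · exact absurd h1 (Finsupp.mem_support_iff.1 hi)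
  · rw [Submodule.mem_comap, derivedVal_polyAction]
    exact L.lie_mem (hx j) hd

include hx in
/-- Derivatives along `x 0` and `x 1` vanish, so that only brackets of the fixed generators occur. -/
theorem contraction_single_mem (j : Fin n) {p : MvPolynomial (Fin (n + 2)) K}
    (hp : ∀ α ∈ p.support, α 0 = 0 ∧ α 1 = 0) :
    derivedVal K _ (contraction K _ (Pi.single j.succ.succ p)) ∈ L := by
  rw [p.as_sum, ← LinearMap.single_apply (R := K), map_sum, map_sum, map_sum]
  refine L.toSubmodule.sum_mem fun α hα => ?_
  obtain ⟨h0, h1⟩ := hp α hα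
  rw [LinearMap.single_apply, contraction_single, map_sum]
  refine L.toSubmodule.sum_mem fun k _ => ?_
  rw [divDegreeSucc_monomial, MvPolynomial.pderiv_monomial]
  obtain rfl | rfl | ⟨k, rfl⟩ := eq_zero_or_one_or_succ_succ k
  · simp [h0]
  · simp [h1]
  · refine polyAction_monomial_mem_subalgebra hx (by simp [h0]) (by simp [h1]) _ ?_
    exact L.lie_mem (hx k) (hx j)

theorem map_incl_eq {S : (Fin (n + 2) →₀ K) →ₗ[K] (Fin (n + 2) →₀ K)}
    (hS : ∀ i : Fin n, S (Finsupp.single i.succ.succ 1) = Finsupp.single i.succ.succ 1)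
    {v : Fin (n + 2) →₀ K} (h0 : v 0 = 0) (h1 : v 1 = 0) : map S (incl K _ v) = incl K _ v := by
  rw [map_incl]
  congr 1
  have hv : v = ∑ i : Fin n, v i.succ.succ • Finsupp.single i.succ.succ 1 := by
    conv_lhs => rw [← Finsupp.univ_sum_single v, Fin.sum_univ_succ, Fin.sum_univ_succ]
    simp [h0, h1]
  rw [hv, map_sum]
  simp only [map_smul, hS]

variable [CharZero K]

include hL hx in
/-- Multiples of the Koszul element `X 0 • e_1 - X 1 • e_0` are images of multiples of `⁅x 0, x 1⁆`
under the Magnus map, and the contraction maps them back to these. -/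
theorem contraction_single_zero_add_mem {p : MvPolynomial (Fin (n + 2)) K}
    (hp : ∀ α ∈ p.support, α 0 = 1 ∧ α 1 = 0) :
    derivedVal K _ (contraction K _
      (Pi.single 0 (-MvPolynomial.rename (Equiv.swap 0 1) p) + Pi.single 1 p)) ∈ L := by
  let φ : MvPolynomial (Fin (n + 2)) K →ₗ[K] FreeMetabelianLieAlgebra K (Fin (n + 2)) :=
    derivedVal K _ ∘ₗ contraction K _ ∘ₗ
      (LinearMap.single K (fun _ => MvPolynomial (Fin (n + 2)) K) 1 -
        LinearMap.single K (fun _ => MvPolynomial (Fin (n + 2)) K) 0 ∘ₗ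
          (MvPolynomial.rename (Equiv.swap 0 1)).toLinearMap)
  have hφ : derivedVal K _ (contraction K _
      (Pi.single 0 (-MvPolynomial.rename (Equiv.swap 0 1) p) + Pi.single 1 p)) = φ p := by
    simp [φ, Pi.single_neg, neg_add_eq_sub]
  rw [hφ, p.as_sum, map_sum]
  refine L.toSubmodule.sum_mem fun α hα => ?_
  obtain ⟨h0, h1⟩ := hp α hα
  -- The exponent `β` of the coefficient by which the Koszul element is multiplied.
  set β := α - Finsupp.single 0 1
  have hα : α = β + Finsupp.single 0 1 := by
    ext i
    by_cases hi : i = 0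
    · subst hi; simp [β, h0]
    · simp [β, Ne.symm hi]
  have hβ0 : β 0 = 0 := by simp [β, h0]
  have hβ1 : β 1 = 0 := by simp [β, h1]
  have hmon : MvPolynomial.monomial α (p.coeff α) =
      MvPolynomial.monomial β (p.coeff α) * MvPolynomial.X 0 := by
    rw [MvPolynomial.X, MvPolynomial.monomial_mul, mul_one, ← hα]
  have hβ : MvPolynomial.rename (Equiv.swap 0 1) (MvPolynomial.monomial β (p.coeff α)) =
      MvPolynomial.monomial β (p.coeff α) := by
    rw [MvPolynomial.rename_monomial]
    refine congrArg (fun γ => MvPolynomial.monomial γ (p.coeff α)) (Finsupp.ext fun i => ?_)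
    rw [Finsupp.mapDomain_equiv_apply, Equiv.symm_swap]
    obtain rfl | rfl | ⟨j, rfl⟩ := eq_zero_or_one_or_succ_succ i
    · rw [Equiv.swap_apply_left, hβ0, hβ1]
    · rw [Equiv.swap_apply_right, hβ0, hβ1]
    · rw [Equiv.swap_apply_of_ne_of_ne (Fin.succ_ne_zero _) (succ_succ_ne_one j)]
  have : φ (MvPolynomial.monomial α (p.coeff α)) =
      derivedVal K _ (polyAction K _ (.monomial β (p.coeff α)) (lieX K 0 1)) := by
    rw [← contraction_lieX, smul_sub, ← Pi.single_smul', ← Pi.single_smul', hmon]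
    simp [φ, hβ]
  rw [this]
  refine polyAction_monomial_mem_subalgebra hx hβ0 hβ1 _ ?_
  rw [lieX_skew, map_neg]
  exact L.neg_mem hL

include hL hx in
theorem contraction_mem_of_invariant {S T : (Fin (n + 2) →₀ K) →ₗ[K] (Fin (n + 2) →₀ K)}
    (hS : IsTorus S) (hT : IsTransvection T) {m : Fin (n + 2) → MvPolynomial (Fin (n + 2)) K}
    (hmS : linAct S m = m) (hmT : linAct T m = m) : derivedVal K _ (contraction K _ m) ∈ L := by
  rw [← Finset.univ_sum_single m, Fin.sum_univ_succ, Fin.sum_univ_succ, ← add_assoc, map_add,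
    map_add, apply_zero_of_invariant hS hT hmS hmT, map_sum, map_sum]
  exact L.add_mem
    (contraction_single_zero_add_mem hL hx fun α => support_one_of_invariant hS hT hmS hmT)
    (L.toSubmodule.sum_mem fun j _ =>
      contraction_single_mem hx j fun α => support_succ_of_invariant hS hT hmS hmT j)

/-- An invariant has no linear terms in `x 0` and `x 1`. -/
theorem IsTorus.incl_eq {S : (Fin (n + 2) →₀ K) →ₗ[K] (Fin (n + 2) →₀ K)}
    (hS : IsTorus S) {a : FreeMetabelianLieAlgebra K (Fin (n + 2))} (ha : map S a = a)
    {v : Fin (n + 2) →₀ K} {d : derived K (Fin (n + 2))} (h : a = incl K _ v + derivedVal K _ d) :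
    v 0 = 0 ∧ v 1 = 0 := by
  have h1 : (magnus K _ a).1 = ∑ k, .C (v k) * .X k := by
    rw [h, map_add, AffineLie.fst_add, magnus_incl, AffineLie.fst_mk]
    exact add_eq_left.2 (fst_magnus_derived d)
  have h2 := magnus_map S a
  rw [ha] at h2
  replace h2 : (magnus K _ a).1 = linSubst S (magnus K _ a).1 := congrArg Prod.fst h2
  have h3 (j : Fin (n + 2)) :
      MvPolynomial.coeff (Finsupp.single j 1) (magnus K _ a).1 = v j := by
    rw [h1, MvPolynomial.coeff_sum]
    simp [MvPolynomial.coeff_C_mul, MvPolynomial.coeff_X, Finsupp.single_left_inj]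
  constructor
  · have h4 := congrArg (MvPolynomial.coeff (Finsupp.single 0 1)) h2
    rw [hS.coeff_linSubst, h3] at h4
    simp at h4
    linear_combination -h4
  · have h4 := congrArg (MvPolynomial.coeff (Finsupp.single 1 1)) h2
    rw [hS.coeff_linSubst, h3] at h4
    simp at h4
    linear_combination 2 * h4

include hL hx in
/-- Invariance under one torus element and one transvection is enough to lie in the subalgebra. -/
theorem mem_of_invariant {S T : (Fin (n + 2) →₀ K) →ₗ[K] (Fin (n + 2) →₀ K)}
    (hS : IsTorus S) (hT : IsTransvection T) {a : FreeMetabelianLieAlgebra K (Fin (n + 2))}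
    (haS : map S a = a) (haT : map T a = a) : a ∈ L := by
  obtain ⟨v, d, h⟩ := exists_incl_add a
  change a = incl K _ v + derivedVal K _ d at h
  obtain ⟨h0, h1⟩ := hS.incl_eq haS h
  have hd (T : (Fin (n + 2) →₀ K) →ₗ[K] (Fin (n + 2) →₀ K))
      (hT : ∀ i : Fin n, T (Finsupp.single i.succ.succ 1) = Finsupp.single i.succ.succ 1)
      (ha : map T a = a) : linAct T (magnusDerived K _ d) = magnusDerived K _ d := by
    rw [h, map_add, map_incl_eq hT h0 h1, add_right_inj] at ha
    have := congrArg Prod.snd (magnus_map T (derivedVal K _ d))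
    rw [ha] at this
    exact this.symm
  rw [h]
  refine L.add_mem ?_ ?_
  · rw [incl, Finsupp.linearCombination_apply, Finsupp.sum_fintype _ _ (by simp),
      Fin.sum_univ_succ, Fin.sum_univ_succ]
    simp only [h0, Fin.succ_zero_eq_one, h1, zero_smul, zero_add]
    exact L.toSubmodule.sum_mem fun i _ => L.smul_mem _ (hx i)
  · rw [← contraction_magnusDerived d]
    exact contraction_mem_of_invariant hL hx hS hT (hd S hS.succ haS) (hd T hT.succ haT)

end FreeMetabelianLieAlgebra

/-! ### The representation -/

section Representation

variable {K : Type u} [Field K]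

/-- The binary forms of degree zero form the trivial representation. -/
theorem binaryForms_zero_apply (g : SL(2, K))
    (f : MvPolynomial.homogeneousSubmodule (Fin 2) K 0) : binaryForms K 0 g f = f := by
  apply Subtype.ext
  change binarySubst K g f = f
  have hf := (MvPolynomial.totalDegree_zero_iff_isHomogeneous _).2
    ((MvPolynomial.mem_homogeneousSubmodule _ _).1 f.2)
  rw [MvPolynomial.totalDegree_eq_zero_iff_eq_C] at hf
  rw [hf, binarySubst, MvPolynomial.aeval_C, MvPolynomial.algebraMap_eq]

/-- The coordinate functions, as binary forms of degree one. -/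
def linearForm (K : Type u) [Field K] (j : Fin 2) : MvPolynomial.homogeneousSubmodule (Fin 2) K 1 :=
  ⟨.X j, MvPolynomial.isHomogeneous_X K j⟩

theorem binaryForms_linearForm (g : SL(2, K)) (j : Fin 2) :
    binaryForms K 1 g (linearForm K j) = ∑ k, (g⁻¹ : SL(2, K)) j k • linearForm K k := by
  apply Subtype.ext
  change binarySubst K g (.X j) = _
  simp [binarySubst, linearForm, MvPolynomial.smul_eq_C_mul, -Matrix.SpecialLinearGroup.coe_inv]

theorem span_linearForm : Submodule.span K (Set.range (linearForm K)) = ⊤ := by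
  apply Submodule.map_injective_of_injective (Submodule.injective_subtype _)
  rw [Submodule.map_span, Submodule.map_top, Submodule.range_subtype]
  refine Eq.trans ?_ MvPolynomial.homogeneousSubmodule_one_eq_span_X.symm
  rw [← Set.range_comp]
  rfl

variable {n : ℕ} {ρ : Representation K SL(2, K) (Fin (n + 2) →₀ K)}
  (e : ρ.Equiv ((binaryForms K 1).prod (Representation.directSum fun _ : Fin n => binaryForms K 0)))

theorem equiv_apply (g : SL(2, K)) (v : Fin (n + 2) →₀ K) :
    e.toLinearEquiv (ρ g v) =
      (binaryForms K 1 g (e.toLinearEquiv v).1, (e.toLinearEquiv v).2) := by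
  have h : e.toLinearEquiv (ρ g v) =
      ((binaryForms K 1).prod (Representation.directSum fun _ : Fin n => binaryForms K 0)) g
        (e.toLinearEquiv v) := LinearMap.congr_fun (e.isIntertwining' g) v
  rw [h]
  refine Prod.ext rfl ?_
  change DirectSum.lmap (fun _ => binaryForms K 0 g) _ = _
  have : (fun _ : Fin n => binaryForms K 0 g) = fun _ => LinearMap.id := by
    ext1 i
    exact LinearMap.ext (binaryForms_zero_apply g)
  rw [this]
  simp

theorem apply_single_succ_succ
    (he₀ : (Submodule.span K (Set.range fun i : Fin n => Finsupp.single i.succ.succ 1)).map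
      e.toLinearEquiv.toLinearMap = Submodule.prod ⊥ ⊤) (g : SL(2, K)) (i : Fin n) :
    ρ g (Finsupp.single i.succ.succ 1) = Finsupp.single i.succ.succ 1 := by
  have h : e.toLinearEquiv (Finsupp.single i.succ.succ 1) ∈
      (Submodule.prod ⊥ ⊤ : Submodule K (_ × _)) := by
    rw [← he₀]
    exact ⟨_, Submodule.subset_span ⟨i, rfl⟩, rfl⟩
  apply e.toLinearEquiv.injective
  rw [equiv_apply]
  refine Prod.ext ?_ rfl
  have h' : (e.toLinearEquiv (Finsupp.single i.succ.succ 1)).1 = 0 := h.1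
  rw [h', _root_.map_zero]

/-- The basis vectors `x_0, x_1`. -/
def planeBasis (K : Type u) [Field K] (n : ℕ) (i : Fin 2) : Fin (n + 2) →₀ K :=
  Finsupp.single (![0, 1] i) 1

theorem linearIndependent_planeBasis : LinearIndependent K (planeBasis K n) := by
  have h : Function.Injective (![0, 1] : Fin 2 → Fin (n + 2)) := by
    intro i j
    fin_cases i <;> fin_cases j <;> simp
  have h' := (Finsupp.basisSingleOne (R := K) (ι := Fin (n + 2))).linearIndependent.comp _ h
  rw [Finsupp.coe_basisSingleOne] at h'
  exact h'

/-- In the basis `x_0, x_1`, the group acts by a conjugate of the natural representation.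
The inverse of `g` comes from the action on functions, `(g • f)(v) = f (g⁻¹ v)`. -/
theorem exists_matrix
    (he₁ : (Submodule.span K {Finsupp.single 0 1, Finsupp.single 1 1}).map
      e.toLinearEquiv.toLinearMap = Submodule.prod ⊤ ⊥) :
    ∃ P Q : Matrix (Fin 2) (Fin 2) K, P * Q = 1 ∧ ∀ (g : SL(2, K)) (i : Fin 2),
      ρ g (planeBasis K n i) =
        ∑ l, (P * ((g⁻¹ : SL(2, K)) : Matrix (Fin 2) (Fin 2) K) * Q) i l • planeBasis K n l := by
  have hspan : Submodule.span K {Finsupp.single 0 1, Finsupp.single 1 1} =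
      Submodule.span K (Set.range (planeBasis K n)) := by
    congr 1
    ext v
    simp [planeBasis, Fin.exists_fin_two, eq_comm]
  rw [hspan] at he₁
  let u (j : Fin 2) : Fin (n + 2) →₀ K := e.toLinearEquiv.symm (linearForm K j, 0)
  have hu (j) : u j ∈ Submodule.span K (Set.range (planeBasis K n)) := by
    have h : e.toLinearEquiv (u j) ∈ (Submodule.prod ⊤ ⊥ : Submodule K (_ × _)) := by
      rw [LinearEquiv.apply_symm_apply]
      exact ⟨trivial, rfl⟩
    rw [← he₁] at h
    obtain ⟨v, hv, h⟩ := h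
    exact e.toLinearEquiv.injective h ▸ hv
  have hx (i) : planeBasis K n i ∈ Submodule.span K (Set.range u) := by
    have h : e.toLinearEquiv (planeBasis K n i) ∈ (Submodule.prod ⊤ ⊥ : Submodule K (_ × _)) := by
      rw [← he₁]
      exact ⟨_, Submodule.subset_span ⟨i, rfl⟩, rfl⟩
    have h2 : (e.toLinearEquiv (planeBasis K n i)).2 = 0 := h.2
    have h1 : (e.toLinearEquiv (planeBasis K n i)).1 ∈
      Submodule.span K (Set.range (linearForm K)) := span_linearForm (K := K) ▸ trivial
    obtain ⟨c, hc⟩ := (Submodule.mem_span_range_iff_exists_fun K).1 h1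
    refine (Submodule.mem_span_range_iff_exists_fun K).2 ⟨c, ?_⟩
    apply e.toLinearEquiv.injective
    rw [map_sum]
    simp only [map_smul, u, LinearEquiv.apply_symm_apply]
    refine Prod.ext ?_ ?_
    · rw [Prod.fst_sum, ← hc]
      rfl
    · rw [Prod.snd_sum, h2]
      exact Finset.sum_eq_zero fun j _ => smul_zero _
  choose Q hQ using fun j => (Submodule.mem_span_range_iff_exists_fun K).1 (hu j)
  choose P hP using fun i => (Submodule.mem_span_range_iff_exists_fun K).1 (hx i)
  have hgu (g : SL(2, K)) (j) : ρ g (u j) = ∑ k, (g⁻¹ : SL(2, K)) j k • u k := by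
    apply e.toLinearEquiv.injective
    rw [equiv_apply, map_sum]
    simp only [map_smul, u, LinearEquiv.apply_symm_apply, binaryForms_linearForm]
    refine Prod.ext ?_ ?_
    · rw [Prod.fst_sum]
      rfl
    · rw [Prod.snd_sum]
      exact (Finset.sum_eq_zero fun k _ => smul_zero _).symm
  have key (g : SL(2, K)) (i : Fin 2) : ρ g (planeBasis K n i) =
      ∑ l, (Matrix.of P * ((g⁻¹ : SL(2, K)) : Matrix (Fin 2) (Fin 2) K) * Matrix.of Q) i l •
        planeBasis K n l := by
    rw [← hP i, map_sum]
    simp only [map_smul, hgu]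
    simp only [← hQ, Matrix.mul_apply, Matrix.of_apply, Fin.sum_univ_two]
    module
  refine ⟨Matrix.of P, Matrix.of Q, ?_, key⟩
  ext i l
  have h1 := key 1 i
  rw [_root_.map_one, inv_one, Matrix.SpecialLinearGroup.coe_one, mul_one, Module.End.one_apply] at h1
  have h2 := (Fintype.linearIndependent_iff.1 (linearIndependent_planeBasis (K := K) (n := n)))
    (fun l => (Matrix.of P * Matrix.of Q) i l - (1 : Matrix (Fin 2) (Fin 2) K) i l) (by
      simp only [sub_smul, Finset.sum_sub_distrib, ← h1]
      simp [Matrix.one_apply]) l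
  exact sub_eq_zero.1 h2

end Representation

end

theorem lemma3p4 {K : Type*} [Field K] [CharZero K] (n : ℕ)
    (ρ : Representation K (Matrix.SpecialLinearGroup (Fin 2) K) (Fin (n + 2) →₀ K))
    (e : ρ.Equiv ((binaryForms K 1).prod
      (Representation.directSum fun _ : Fin n => binaryForms K 0)))
    (he₁ : (Submodule.span K {Finsupp.single 0 1, Finsupp.single 1 1}).map
      e.toLinearEquiv.toLinearMap = Submodule.prod ⊤ ⊥)
    (he₀ : (Submodule.span K (Set.range fun i : Fin n => Finsupp.single i.succ.succ 1)).map
      e.toLinearEquiv.toLinearMap = Submodule.prod ⊥ ⊤) :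
    LieSubalgebra.lieSpan K (FreeMetabelianLieAlgebra K (Fin (n + 2)))
      ({⁅FreeMetabelianLieAlgebra.x K (1 : Fin (n + 2)),
          FreeMetabelianLieAlgebra.x K (0 : Fin (n + 2))⁆} ∪
        Set.range fun i : Fin n => FreeMetabelianLieAlgebra.x K i.succ.succ) =
      FreeMetabelianLieAlgebra.invariants ρ := by
  open FreeMetabelianLieAlgebra in
  obtain ⟨P, Q, hPQ, hρ⟩ := exists_matrix e he₁
  have hρ₀ := apply_single_succ_succ e he₀
  have hb0 : planeBasis K n 0 = Finsupp.single 0 1 := rfl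
  have hb1 : planeBasis K n 1 = Finsupp.single 1 1 := rfl
  -- Conjugation permutes the matrices of determinant one, so each of them occurs as an action.
  have hsurj (h : Matrix (Fin 2) (Fin 2) K) (hdet : h.det = 1) :
      ∃ g : SL(2, K), ∀ i, ρ g (planeBasis K n i) = ∑ l, h i l • planeBasis K n l := by
    have hd : (Q * h * P).det = 1 := by
      rw [Matrix.det_mul_right_comm, mul_eq_one_comm.1 hPQ, one_mul, hdet]
    let g : SL(2, K) := ⟨Q * h * P, hd⟩
    refine ⟨g⁻¹, fun i => ?_⟩
    have hg : P * (g : Matrix (Fin 2) (Fin 2) K) * Q = h := by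
      change P * (Q * h * P) * Q = h
      rw [mul_assoc, mul_assoc _ P Q, hPQ, mul_one, ← mul_assoc, hPQ, one_mul]
    rw [hρ, inv_inv, hg]
  apply le_antisymm
  · rw [LieSubalgebra.lieSpan_le]
    rintro _ (rfl | ⟨i, rfl⟩) g
    · change FreeMetabelianLieAlgebra.map (ρ g) _ = _
      set h := P * ((g⁻¹ : SL(2, K)) : Matrix (Fin 2) (Fin 2) K) * Q with hh
      have hdet : h.det = 1 := by
        rw [hh, Matrix.det_mul_right_comm, hPQ, one_mul, Matrix.SpecialLinearGroup.det_coe]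
      rw [Matrix.det_fin_two] at hdet
      rw [LieHom.map_lie, map_x, map_x, ← hb0, ← hb1, hρ, hρ, ← hh]
      simp only [Fin.sum_univ_two, hb0, hb1, map_add, map_smul, incl,
        Finsupp.linearCombination_single, one_smul, add_lie, lie_add, smul_lie,
        lie_smul, lie_self, smul_zero, zero_add, add_zero]
      rw [← lie_skew (x K (0 : Fin (n + 2)))]
      trans (h 0 0 * h 1 1 - h 0 1 * h 1 0) • ⁅x K (1 : Fin (n + 2)), x K (0 : Fin (n + 2))⁆
      · module
      · rw [hdet, one_smul]
    · change FreeMetabelianLieAlgebra.map (ρ g) _ = _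
      simp only [map_x, hρ₀, incl, Finsupp.linearCombination_single, one_smul]
  · intro a ha
    obtain ⟨g, hg⟩ := hsurj !![2, 0; 0, 2⁻¹] (by simp)
    obtain ⟨g', hg'⟩ := hsurj !![1, 0; 1, 1] (by simp)
    refine mem_of_invariant (S := ρ g) (T := ρ g') ?_ ?_ ⟨?_, ?_, hρ₀ g⟩ ⟨?_, ?_, hρ₀ g'⟩
      (ha g) (ha g')
    · exact LieSubalgebra.subset_lieSpan (Or.inl rfl)
    · exact fun i => LieSubalgebra.subset_lieSpan (Or.inr ⟨i, rfl⟩)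
    · simpa [hb0, hb1] using hg 0
    · simpa [hb0, hb1] using hg 1
    · simpa [hb0, hb1] using hg' 0
    · simpa [hb0, hb1] using hg' 1
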